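/- **Setting.** Let $M\ge 1$ be an integer and let $\rho,q,\sigma>0$. Users $1,\dots,K$ have channel gains $\beta_1,\dots,\beta_K>0$. Let $\mathcal S\subseteq\{1,\dots,K\}$ be the set of users that send a given pilot, let $k\in\mathcal S$, and put $\alpha_{\mathcal S}=\sum_{i\in\mathcal S}\beta_i$. Let $h_i\sim\mathcal{CN}(0,\beta_i I_M)$ ($i=1,\dots,K$), $n\sim\mathcal{CN}(0,\sigma^2 I_M)$ and $\eta_k\sim\mathcal{CN}(0,\sigma^2)$ be mutually independent, where $\mathcal{CN}$ denotes circularly symmetric complex Gaussian laws. Put $$y=\sum_{i\in\mathcal S}\sqrt{\rho}\,h_i+n,\qquad \hat h=\frac{y}{\sqrt\rho},\qquad w=\sqrt q\,\frac{\hat h}{\|\hat h\|},\qquad z_k=h_k^{\mathrm H}w+\eta_k=z_{\Re}+\mathrm j z_{\Im}.$$ For $\alpha\ge\beta_k$ let $$\lambda_1=\frac{\rho q\beta_k^2}{\rho\alpha+\sigma^2},\qquad \lambda_2=\sigma^2+q\beta_k-\lambda_1,$$ $$f_1(x\,|\,\alpha)=\frac{e^{-\frac{x^2}{\lambda_2}\left(1-\frac{\lambda_1}{\lambda_1+\lambda_2}\right)}}{\Gamma(M)\lambda_1^M\sqrt{\pi\lambda_2}}\sum_{n=0}^{2M-1}\binom{2M-1}{n}\frac{\Gamma\left(\frac{n+1}{2}\right)+c_n(x)\,\gamma\left(\frac{n+1}{2},\frac{x^2}{\lambda_2}\frac{\lambda_1}{\lambda_1+\lambda_2}\right)}{\left(\frac{x}{\lambda_2}\right)^{n+1-2M}\left(\frac1{\lambda_1}+\frac1{\lambda_2}\right)^{2M-\frac{n+1}{2}}},$$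 $$f_2(y\,|\,\alpha)=\frac{1}{\sqrt{\pi\lambda_2}}\,e^{-y^2/\lambda_2},$$ where $c_n(x)=(-1)^n$ if $x>0$, $c_n(x)=-1$ if $x<0$, and $\gamma(s,x)=\int_0^x t^{s-1}e^{-t}\,dt$ is the lower incomplete gamma function; at $x=0$, $f_1$ is defined by its limit for $x\to0$, in which only the summand $n=2M-1$ survives. **Theorem.** 1. If $\alpha_{\mathcal S}=\alpha$, then $f_1(\cdot\,|\,\alpha)$ is the (continuous) probability density function of $z_{\Re}$, $f_2(\cdot\,|\,\alpha)$ is that of $z_{\Im}$, and $(x,y)\mapsto f_1(x\,|\,\alpha)f_2(y\,|\,\alpha)$ is that of $(z_{\Re},z_{\Im})$. 2. The maximum-likelihood estimate of $\alpha_{\mathcal S}$ from an observation $z_k=z_{\Re}+\mathrm jz_{\Im}$, that is, a maximizer over $\alpha\ge\beta_k$ of the continuous joint density of $(z_{\Re},z_{\Im})$ given $\alpha_{\mathcal S}=\alpha$, is $$\hat\alpha^{\mathrm{ML}}_{\mathcal S,k}=\operatorname*{arg\,max}_{\alpha\ge\beta_k}\; f_1(z_{\Re}\,|\,\alpha)\,f_2(z_{\Im}\,|\,\alpha),$$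 as an equality of (possibly empty) sets of maximizers, for every $z_k\in\mathbb C$. -/

import Mathlib

open MeasureTheory ProbabilityTheory

noncomputable section

namespace PilotContention

/-- The circularly symmetric complex Gaussian law `CN(0, v)` on `ℂ`: independent real and
imaginary parts, each `N(0, v / 2)`. -/
def complexGaussian (v : ℝ) : Measure ℂ :=
  ((gaussianReal 0 (v / 2).toNNReal).prod (gaussianReal 0 (v / 2).toNNReal)).map
    (fun p => (⟨p.1, p.2⟩ : ℂ))

/-- The law `CN(0, v I_M)` on `ℂ^M`: independent coordinates, each `CN(0, v)`. -/
def complexGaussianVec (M : ℕ) (v : ℝ) : Measure (EuclideanSpace ℂ (Fin M)) :=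
  (Measure.pi (fun _ : Fin M => complexGaussian v)).map (WithLp.toLp 2)

/-- The received uplink pilot signal `y = ∑_{i ∈ S} √ρ h_i + n` at the base station. -/
def uplinkSignal {M K : ℕ} (ρ : ℝ) (S : Finset (Fin K))
    (h : Fin K → EuclideanSpace ℂ (Fin M)) (n : EuclideanSpace ℂ (Fin M)) :
    EuclideanSpace ℂ (Fin M) :=
  ∑ i ∈ S, ((Real.sqrt ρ : ℝ) : ℂ) • h i + n

/-- The least-squares channel estimate `y / √ρ`. -/
def lsEstimate {M K : ℕ} (ρ : ℝ) (S : Finset (Fin K))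
    (h : Fin K → EuclideanSpace ℂ (Fin M)) (n : EuclideanSpace ℂ (Fin M)) :
    EuclideanSpace ℂ (Fin M) :=
  ((1 / Real.sqrt ρ : ℝ) : ℂ) • uplinkSignal ρ S h n

/-- The precoding vector `w = √q ĥ / ‖ĥ‖`, with `ĥ` the least-squares estimate and `‖·‖` the
Euclidean norm (the event `ĥ = 0` has probability zero). -/
def precoder {M K : ℕ} (ρ q : ℝ) (S : Finset (Fin K))
    (h : Fin K → EuclideanSpace ℂ (Fin M)) (n : EuclideanSpace ℂ (Fin M)) :
    EuclideanSpace ℂ (Fin M) :=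
  ((Real.sqrt q / ‖lsEstimate ρ S h n‖ : ℝ) : ℂ) • lsEstimate ρ S h n

/-- The received downlink pilot signal `z_k = h_kᴴ w + η_k` at user `k`
(the inner product is conjugate-linear in its first argument). -/
def receivedSignal {M K : ℕ} (ρ q : ℝ) (S : Finset (Fin K)) (k : Fin K)
    (h : Fin K → EuclideanSpace ℂ (Fin M)) (n : EuclideanSpace ℂ (Fin M)) (η : ℂ) : ℂ :=
  inner ℂ (h k) (precoder ρ q S h n) + η

/-- The random quantities of the model on a probability space: channels
`h_i ∼ CN(0, β_i I_M)`, base station noise `n ∼ CN(0, σ² I_M)` and user noise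
`η ∼ CN(0, σ²)`, all mutually independent. -/
structure IsRayleighModel {Ω : Type*} [MeasurableSpace Ω] (P : Measure Ω) {M K : ℕ}
    (σ : ℝ) (β : Fin K → ℝ) (h : Fin K → Ω → EuclideanSpace ℂ (Fin M))
    (n : Ω → EuclideanSpace ℂ (Fin M)) (η : Ω → ℂ) : Prop where
  law_channel : ∀ i, HasLaw (h i) (complexGaussianVec M (β i)) P
  law_noise : HasLaw n (complexGaussianVec M (σ ^ 2)) P
  law_userNoise : HasLaw η (complexGaussian (σ ^ 2)) P
  indep_channels_noise : iIndepFun (fun o : Option (Fin K) => o.elim n h) P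
  indep_userNoise : IndepFun (fun ω => (fun i => h i ω, n ω)) η P

/-- The law of `(Re z_k, Im z_k)` when the users in `S` send the pilot and the channel gains
are `β`, computed on the product probability space of all channels and noises. -/
def signalLaw (M : ℕ) {K : ℕ} (ρ q σ : ℝ) (β : Fin K → ℝ) (S : Finset (Fin K)) (k : Fin K) :
    Measure (ℝ × ℝ) :=
  (((Measure.pi (fun i => complexGaussianVec M (β i))).prod
      (complexGaussianVec M (σ ^ 2))).prod (complexGaussian (σ ^ 2))).map
    (fun p => ((receivedSignal ρ q S k p.1.1 p.1.2 p.2).re,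
      (receivedSignal ρ q S k p.1.1 p.1.2 p.2).im))

/-- `p` is the continuous probability density function of `μ` (with respect to Lebesgue
measure). On `ℝ` and `ℝ × ℝ` there is at most one such function. -/
def IsContinuousPDF {E : Type*} [MeasureSpace E] [TopologicalSpace E]
    (μ : Measure E) (p : E → ℝ) : Prop :=
  Continuous p ∧ (∀ x, 0 ≤ p x) ∧ μ = volume.withDensity (fun x => ENNReal.ofReal (p x))

/-- `L α` is the joint PDF of `(Re z_k, Im z_k)` given that the sum of the channel gains of
the users in `S` equals `α`, for a user `k ∈ S` with gain `b`: whatever the number of users,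
the set `S` and the gains are, subject to this. -/
def IsLikelihood (M : ℕ) (ρ q σ b : ℝ) (L : ℝ → ℝ × ℝ → ℝ) : Prop :=
  ∀ (K : ℕ) (β : Fin K → ℝ) (S : Finset (Fin K)) (k : Fin K),
    (∀ i, 0 < β i) → k ∈ S → β k = b →
      IsContinuousPDF (signalLaw M ρ q σ β S k) (L (∑ i ∈ S, β i))

/-- The set of maximizers of `F` over `A`. -/
def argmaxOn (A : Set ℝ) (F : ℝ → ℝ) : Set ℝ := {a | a ∈ A ∧ IsMaxOn F A a}

/-- The maximum likelihood estimates of the sum of the channel gains, at a user with gain `b`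
that observes `z`. -/
def mlEstimates (M : ℕ) (ρ q σ b : ℝ) (z : ℂ) : Set ℝ :=
  {a | ∃ L : ℝ → ℝ × ℝ → ℝ, IsLikelihood M ρ q σ b L ∧
    a ∈ argmaxOn (Set.Ici b) (fun α => L α (z.re, z.im))}

/-- The lower incomplete gamma function `γ(s, x)`. -/
def lowerGamma (s x : ℝ) : ℝ := ∫ t in (0 : ℝ)..x, t ^ (s - 1) * Real.exp (-t)

/-- `λ₁ = ρ q b² / (ρ α + σ²)`. -/
def lam1 (ρ q σ b α : ℝ) : ℝ := ρ * q * b ^ 2 / (ρ * α + σ ^ 2)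

/-- `λ₂ = σ² + q b - λ₁`. -/
def lam2 (ρ q σ b α : ℝ) : ℝ := σ ^ 2 + q * b - lam1 ρ q σ b α

/-- The sign `c_n(x)`: `(-1)^n` for `x > 0` and `-1` for `x < 0` (its value at `x = 0` is
immaterial, since it multiplies `γ(s, 0) = 0` there). -/
def signCoeff (n : ℕ) (x : ℝ) : ℝ := if 0 < x then (-1) ^ n else -1

/-- The density `f₁(x | α)`. The power of `x / λ₂` in the denominator has the integer exponent
`n + 1 - 2M ≤ 0`. At `x = 0` only the summand `n = 2M - 1`, with exponent `0`, is nonzero, so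
that the formula gives the limit for `x → 0`. -/
def f1 (M : ℕ) (ρ q σ b x α : ℝ) : ℝ :=
  let l₁ := lam1 ρ q σ b α
  let l₂ := lam2 ρ q σ b α
  Real.exp (-(x ^ 2 / l₂) * (1 - l₁ / (l₁ + l₂)))
      / (Real.Gamma M * l₁ ^ M * Real.sqrt (Real.pi * l₂)) *
    ∑ n ∈ Finset.range (2 * M), ((2 * M - 1).choose n : ℝ) *
      ((Real.Gamma (((n : ℝ) + 1) / 2) +
          signCoeff n x * lowerGamma (((n : ℝ) + 1) / 2) (x ^ 2 / l₂ * (l₁ / (l₁ + l₂)))) /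
        ((x / l₂) ^ ((n : ℤ) + 1 - 2 * (M : ℤ)) *
          (1 / l₁ + 1 / l₂) ^ (2 * (M : ℝ) - ((n : ℝ) + 1) / 2)))

/-- The density `f₂(y | α)`, which is that of `N(0, λ₂ / 2)`. -/
def f2 (ρ q σ b y α : ℝ) : ℝ :=
  let l₂ := lam2 ρ q σ b α
  1 / Real.sqrt (Real.pi * l₂) * Real.exp (-(y ^ 2 / l₂))

end PilotContention

end

/-!
The scaled observation `x = c y` with `c = √q √ρ β_k / (ρ α + σ²)` is the linear MMSE estimate of
`√q h_k`, so it is independent of the residual `u = √q h_k - x`, the two being uncorrelated and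
jointly Gaussian. As the precoder is `w = √q x / ‖x‖`, the received signal is
`z = ‖x‖ + ⟪u, x / ‖x‖⟫ + η`. Given `x`, the last two terms have the law `CN(0, λ₂)`, which does
not depend on `x`. Hence `Re z` and `Im z` are independent, `Im z ∼ N(0, λ₂ / 2)`, and `Re z` is
the sum of an independent Nakagami variable `‖x‖` and a variable `N(0, λ₂ / 2)`. Completing the
square in the convolution and expanding the power of `r` about the centre gives `f₁`.

Every `α ≥ b` is the sum of the gains in some configuration, and a law has at most one continuous
density, so any two likelihoods agree on the range of the maximization.
-/

namespace PilotContention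

open Complex (I)
open Set (Ioi Ioc)

instance isProbabilityMeasure_complexGaussian (v : ℝ) :
    IsProbabilityMeasure (complexGaussian v) :=
  Measure.isProbabilityMeasure_map
    Complex.measurableEquivRealProd.symm.measurable.aemeasurable

instance isProbabilityMeasure_complexGaussianVec (M : ℕ) (v : ℝ) :
    IsProbabilityMeasure (complexGaussianVec M v) :=
  Measure.isProbabilityMeasure_map (by fun_prop)

theorem sum_mul_norm_smul_add_sq {ι V : Type*} [Fintype ι] [NormedAddCommGroup V]
    [InnerProductSpace ℝ V] {v a b : ι → ℝ}
    (hab : ∑ i, v i * a i * b i = 0) (x y : V) :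
    ∑ i, v i * ‖a i • x + b i • y‖ ^ 2 =
      (∑ i, v i * a i ^ 2) * ‖x‖ ^ 2 + (∑ i, v i * b i ^ 2) * ‖y‖ ^ 2 := by
  have hsq (i : ι) : v i * ‖a i • x + b i • y‖ ^ 2 =
      v i * a i ^ 2 * ‖x‖ ^ 2 + v i * b i ^ 2 * ‖y‖ ^ 2 + v i * a i * b i * (2 * inner ℝ x y) := by
    rw [norm_add_sq_real, norm_smul, norm_smul, mul_pow, mul_pow, Real.norm_eq_abs, sq_abs,
      Real.norm_eq_abs, sq_abs, real_inner_smul_left, real_inner_smul_right]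
    ring
  simp_rw [hsq, Finset.sum_add_distrib, ← Finset.sum_mul, hab, zero_mul, add_zero]

section IsotropicGaussian

variable (V : Type*) [NormedAddCommGroup V] [InnerProductSpace ℝ V] [FiniteDimensional ℝ V]
  [MeasurableSpace V] [BorelSpace V]

/-- The centred Gaussian law on a Euclidean space `V` whose covariance is `v / 2` times the
identity. The scaling is that of circularly symmetric complex laws: on `ℂ` this is `CN(0, v)`. -/
noncomputable def isotropicGaussian (v : ℝ) : Measure V :=
  (stdGaussian V).map (√(v / 2) • ·)

instance isProbabilityMeasure_isotropicGaussian (v : ℝ) :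
    IsProbabilityMeasure (isotropicGaussian V v) :=
  Measure.isProbabilityMeasure_map (by fun_prop)

variable {V}

theorem charFun_isotropicGaussian {v : ℝ} (hv : 0 ≤ v) (t : V) :
    charFun (isotropicGaussian V v) t = Complex.exp (-(v / 4 * ‖t‖ ^ 2 : ℝ)) := by
  rw [isotropicGaussian, charFun_map_smul, charFun_stdGaussian, norm_smul, Real.norm_eq_abs,
    abs_of_nonneg (Real.sqrt_nonneg _), ← Complex.ofReal_pow, mul_pow, Real.sq_sqrt (by positivity)]
  congr 1
  push_cast
  ring

theorem isotropicGaussian_conv {v w : ℝ} (hv : 0 ≤ v) (hw : 0 ≤ w) :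
    isotropicGaussian V v ∗ isotropicGaussian V w = isotropicGaussian V (v + w) := by
  refine Measure.ext_of_charFun (funext fun t => ?_)
  rw [charFun_conv, charFun_isotropicGaussian hv, charFun_isotropicGaussian hw,
    charFun_isotropicGaussian (add_nonneg hv hw), ← Complex.exp_add]
  push_cast
  ring_nf

theorem isotropicGaussian_complex {v : ℝ} (hv : 0 ≤ v) :
    isotropicGaussian ℂ v = complexGaussian v := by
  refine Measure.ext_of_charFun (funext fun t => ?_)
  have hmeas : Measurable (fun p : ℝ × ℝ => (⟨p.1, p.2⟩ : ℂ)) :=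
    Complex.measurableEquivRealProd.symm.measurable
  have hsplit (p : ℝ × ℝ) : Complex.exp ((inner ℝ (⟨p.1, p.2⟩ : ℂ) t : ℝ) * I) =
      Complex.exp (t.re * p.1 * I) * Complex.exp (t.im * p.2 * I) := by
    rw [← Complex.exp_add, Complex.inner]
    simp only [Complex.mul_re, Complex.conj_re, Complex.conj_im]
    push_cast
    ring_nf
  rw [charFun_isotropicGaussian hv, complexGaussian, charFun_apply,
    integral_map hmeas.aemeasurable (by fun_prop)]
  simp_rw [hsplit]
  rw [integral_prod_mul (fun x : ℝ => Complex.exp (t.re * x * I))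
      (fun x : ℝ => Complex.exp (t.im * x * I)),
    ← charFun_apply_real, ← charFun_apply_real, charFun_gaussianReal, charFun_gaussianReal,
    ← Complex.exp_add, Complex.sq_norm, Complex.normSq_apply, Real.coe_toNNReal _ (by positivity)]
  push_cast
  ring_nf

theorem charFun_pi_isotropicGaussian {ι : Type*} [Fintype ι] {v : ι → ℝ} (hv : ∀ i, 0 ≤ v i)
    (t : PiLp 2 fun _ : ι => V) :
    charFun ((Measure.pi fun i => isotropicGaussian V (v i)).map (WithLp.toLp 2)) t =
      Complex.exp (-((∑ i, v i * ‖t i‖ ^ 2) / 4 : ℝ)) := by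
  rw [charFun_pi]
  simp_rw [charFun_isotropicGaussian (hv _), ← Complex.exp_sum, Finset.sum_neg_distrib,
    ← Complex.ofReal_sum, Finset.sum_div]
  ring_nf

theorem isotropicGaussian_euclideanSpace (M : ℕ) {v : ℝ} (hv : 0 ≤ v) :
    isotropicGaussian (EuclideanSpace ℂ (Fin M)) v = complexGaussianVec M v := by
  refine Measure.ext_of_charFun (funext fun t => ?_)
  rw [charFun_isotropicGaussian hv, complexGaussianVec, ← isotropicGaussian_complex hv,
    charFun_pi_isotropicGaussian fun _ => hv, ← Finset.mul_sum, EuclideanSpace.norm_sq_eq]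
  ring_nf

theorem hasLaw_sum_smul_prod {ι Ω : Type*} [Fintype ι] [MeasurableSpace Ω] {P : Measure Ω}
    {X : ι → Ω → V} {v a b : ι → ℝ} (hX : iIndepFun X P)
    (hlaw : ∀ i, HasLaw (X i) (isotropicGaussian V (v i)) P) (hv : ∀ i, 0 ≤ v i)
    (hab : ∑ i, v i * a i * b i = 0) :
    HasLaw (fun ω => (∑ i, a i • X i ω, ∑ i, b i • X i ω))
      ((isotropicGaussian V (∑ i, v i * a i ^ 2)).prod
        (isotropicGaussian V (∑ i, v i * b i ^ 2))) P := by
  have hjoint := hX.hasLaw_pi hlaw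
  have hmeas : Measurable fun x : ι → V => (∑ i, a i • x i, ∑ i, b i • x i) := by fun_prop
  suffices h : (Measure.pi fun i => isotropicGaussian V (v i)).map
      (fun x => (∑ i, a i • x i, ∑ i, b i • x i)) =
      (isotropicGaussian V (∑ i, v i * a i ^ 2)).prod
        (isotropicGaussian V (∑ i, v i * b i ^ 2)) from
    HasLaw.fun_comp ⟨hmeas.aemeasurable, h⟩ hjoint
  have := Measure.isProbabilityMeasure_map hmeas.aemeasurable
    (μ := Measure.pi fun i => isotropicGaussian V (v i))
  refine charFun_eq_prod_iff.1 fun t => ?_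
  have hinner (x : ι → V) : inner ℝ (WithLp.toLp 2 (∑ i, a i • x i, ∑ i, b i • x i)) t =
      inner ℝ (WithLp.toLp 2 x) (WithLp.toLp 2 fun i => a i • t.fst + b i • t.snd) := by
    simp only [WithLp.prod_inner_apply, PiLp.inner_apply, sum_inner, inner_add_right,
      real_inner_smul_left, real_inner_smul_right, Finset.sum_add_distrib]
    rfl
  calc charFun (((Measure.pi fun i => isotropicGaussian V (v i)).map
          fun x => (∑ i, a i • x i, ∑ i, b i • x i)).map (WithLp.toLp 2)) t
    _ = charFun ((Measure.pi fun i => isotropicGaussian V (v i)).map (WithLp.toLp 2))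
          (WithLp.toLp 2 fun i => a i • t.fst + b i • t.snd) := by
        rw [Measure.map_map (by fun_prop) hmeas, charFun_apply, charFun_apply,
          integral_map (by fun_prop) (by fun_prop), integral_map (by fun_prop) (by fun_prop)]
        simp only [Function.comp_apply, hinner]
    _ = _ := by
        rw [charFun_pi_isotropicGaussian hv, sum_mul_norm_smul_add_sq hab,
          charFun_isotropicGaussian (Finset.sum_nonneg fun i _ => mul_nonneg (hv i) (sq_nonneg _)),
          charFun_isotropicGaussian (Finset.sum_nonneg fun i _ => mul_nonneg (hv i) (sq_nonneg _)),
          ← Complex.exp_add, ← Complex.ofReal_neg, ← Complex.ofReal_neg, ← Complex.ofReal_neg,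
          ← Complex.ofReal_add]
        congr 2
        simp only [WithLp.fst, WithLp.snd]
        ring

theorem isotropicGaussian_map_inner {ι : Type*} [Fintype ι] {v : ℝ} (hv : 0 ≤ v)
    {e : EuclideanSpace ℂ ι} (he : ‖e‖ = 1) :
    (isotropicGaussian (EuclideanSpace ℂ ι) v).map (fun u => inner ℂ u e) =
      isotropicGaussian ℂ v := by
  have hmeas : Measurable fun u : EuclideanSpace ℂ ι => inner ℂ u e := by fun_prop
  have := Measure.isProbabilityMeasure_map hmeas.aemeasurable
    (μ := isotropicGaussian (EuclideanSpace ℂ ι) v)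
  refine Measure.ext_of_charFun (funext fun t => ?_)
  have hinner (u : EuclideanSpace ℂ ι) :
      inner ℝ (inner ℂ u e) t = inner ℝ u (star t • e) := by
    have hre : inner ℝ u (star t • e) = (inner ℂ u (star t • e)).re := by
      simp only [PiLp.inner_apply, Complex.re_sum]; rfl
    rw [hre, inner_smul_right, real_inner_comm, Complex.inner, mul_comm]
    rfl
  rw [charFun_apply, integral_map hmeas.aemeasurable (by fun_prop)]
  simp_rw [hinner]
  rw [← charFun_apply, charFun_isotropicGaussian hv, charFun_isotropicGaussian hv, norm_smul, he,
    mul_one, norm_star]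

end IsotropicGaussian

theorem map_norm_withDensity {V : Type*} [NormedAddCommGroup V] [NormedSpace ℝ V]
    [FiniteDimensional ℝ V] [Nontrivial V] [MeasurableSpace V] [BorelSpace V]
    (μ : Measure V) [μ.IsAddHaarMeasure] {g : ℝ → ℝ} (hg : ∀ r, 0 ≤ g r)
    (hint : Integrable (fun x => g ‖x‖) μ) :
    (μ.withDensity fun x => ENNReal.ofReal (g ‖x‖)).map norm =
      (volume.restrict (Ioi 0)).withDensity fun r => ENNReal.ofReal
        (Module.finrank ℝ V * μ.real (Metric.ball 0 1) * (r ^ (Module.finrank ℝ V - 1) * g r)) := by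
  have hradial : Integrable (fun r => Module.finrank ℝ V * μ.real (Metric.ball 0 1) *
      (r ^ (Module.finrank ℝ V - 1) * g r)) (volume.restrict (Ioi 0)) :=
    ((integrable_fun_norm_addHaar μ).1 hint).const_mul _
  ext A hA
  rw [Measure.map_apply measurable_norm hA, withDensity_apply _ (measurable_norm hA),
    withDensity_apply _ hA,
    ← ofReal_integral_eq_lintegral_ofReal hint.restrict (.of_forall fun x => hg ‖x‖),
    ← ofReal_integral_eq_lintegral_ofReal hradial.restrict
      (ae_restrict_of_ae <| (ae_restrict_mem measurableSet_Ioi).mono fun r (hr : 0 < r) => by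
        have := hg r; positivity),
    integral_const_mul, ← integral_indicator (measurable_norm hA), ← integral_indicator hA]
  have hpre : (norm ⁻¹' A).indicator (fun x : V => g ‖x‖) = fun x => A.indicator g ‖x‖ := rfl
  rw [hpre, integral_fun_norm_addHaar μ (A.indicator g), nsmul_eq_mul, smul_eq_mul, mul_assoc]
  simp_rw [smul_eq_mul, Set.indicator_mul_right A (fun r : ℝ => r ^ (Module.finrank ℝ V - 1))]

section GaussianDensity

variable {V : Type*} [NormedAddCommGroup V] [InnerProductSpace ℝ V] [FiniteDimensional ℝ V]
  [MeasurableSpace V] [BorelSpace V]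

theorem integrable_exp_neg_norm_sq_div {v : ℝ} (hv : 0 < v) :
    Integrable fun x : V => Real.exp (-(‖x‖ ^ 2 / v)) := by
  have h := (GaussianFourier.integrable_cexp_neg_mul_sq_norm_add (V := V) (b := (1 / v : ℝ))
    (by simpa using hv) 0 0).re
  refine h.congr (.of_forall fun x => ?_)
  have : -((1 / v : ℝ) : ℂ) * (‖x‖ : ℂ) ^ 2 + 0 * ((inner ℝ (0 : V) x : ℝ) : ℂ) =
    ((-(‖x‖ ^ 2 / v) : ℝ) : ℂ) := by push_cast; ring
  simp only [this]
  exact Complex.exp_ofReal_re _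

theorem integral_exp_neg_norm_sq_div_mul_cexp_inner {v : ℝ} (hv : 0 < v) (t : V) :
    ∫ x : V, (Real.exp (-(‖x‖ ^ 2 / v)) : ℂ) * Complex.exp (inner ℝ x t * I) =
      ((Real.pi * v) ^ (Module.finrank ℝ V / 2 : ℝ) : ℝ) *
        Complex.exp (-(v / 4 * ‖t‖ ^ 2 : ℝ)) := by
  have hv' : (v : ℂ) ≠ 0 := by exact_mod_cast hv.ne'
  have hexp (x : V) : (Real.exp (-(‖x‖ ^ 2 / v)) : ℂ) * Complex.exp (inner ℝ x t * I) =
      Complex.exp (-((1 / v : ℝ) : ℂ) * (‖x‖ : ℂ) ^ 2 + I * (inner ℝ t x : ℝ)) := by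
    rw [Complex.exp_add, real_inner_comm, mul_comm I, Complex.ofReal_exp]
    push_cast
    ring_nf
  simp_rw [hexp]
  rw [GaussianFourier.integral_cexp_neg_mul_sq_norm_add (by simpa using hv),
    Complex.ofReal_cpow (by positivity), Complex.I_sq]
  push_cast
  congr 2 <;> field_simp

theorem isotropicGaussian_eq_withDensity {v : ℝ} (hv : 0 < v) :
    isotropicGaussian V v = volume.withDensity fun x => ENNReal.ofReal
      (((Real.pi * v) ^ (Module.finrank ℝ V / 2 : ℝ))⁻¹ * Real.exp (-(‖x‖ ^ 2 / v))) := by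
  set c : ℝ := (Real.pi * v) ^ (Module.finrank ℝ V / 2 : ℝ)
  have hc : 0 < c := Real.rpow_pos_of_pos (by positivity) _
  have : IsFiniteMeasure
      (volume.withDensity fun x : V => ENNReal.ofReal (c⁻¹ * Real.exp (-(‖x‖ ^ 2 / v)))) :=
    isFiniteMeasure_withDensity_ofReal ((integrable_exp_neg_norm_sq_div hv).const_mul _).2
  refine Measure.ext_of_charFun (funext fun t => ?_)
  rw [charFun_isotropicGaussian hv.le, charFun_apply,
    integral_withDensity_eq_integral_toReal_smul (by fun_prop) (by simp)]
  have hsmul (x : V) : (ENNReal.ofReal (c⁻¹ * Real.exp (-(‖x‖ ^ 2 / v)))).toReal •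
      Complex.exp (inner ℝ x t * I) =
      (c⁻¹ : ℝ) * ((Real.exp (-(‖x‖ ^ 2 / v)) : ℂ) * Complex.exp (inner ℝ x t * I)) := by
    rw [ENNReal.toReal_ofReal (by positivity), Complex.real_smul, Complex.ofReal_mul, mul_assoc]
  simp_rw [hsmul]
  rw [integral_const_mul, integral_exp_neg_norm_sq_div_mul_cexp_inner hv, ← mul_assoc,
    ← Complex.ofReal_mul, inv_mul_cancel₀ hc.ne', Complex.ofReal_one, one_mul]

/-- The density on `(0, ∞)` of the Nakagami law of the norm of a `CN(0, v I_M)` vector. -/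
noncomputable def nakagamiDensity (M : ℕ) (v r : ℝ) : ℝ :=
  2 * r ^ (2 * M - 1) * Real.exp (-(r ^ 2 / v)) / (Real.Gamma M * v ^ M)

theorem nakagamiDensity_nonneg (M : ℕ) {v r : ℝ} (hv : 0 ≤ v) (hr : 0 ≤ r) :
    0 ≤ nakagamiDensity M v r := by
  have : 0 ≤ Real.Gamma M := Real.Gamma_nonneg_of_nonneg (by positivity)
  rw [nakagamiDensity]
  positivity

/-- The Nakagami law: that of the norm of a `CN(0, v I_M)` vector. -/
noncomputable def nakagami (M : ℕ) (v : ℝ) : Measure ℝ :=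
  (volume.restrict (Ioi 0)).withDensity fun r => ENNReal.ofReal (nakagamiDensity M v r)

theorem isotropicGaussian_map_norm [Nontrivial V] {M : ℕ} (hM : Module.finrank ℝ V = 2 * M)
    {v : ℝ} (hv : 0 < v) :
    (isotropicGaussian V v).map norm = nakagami M v := by
  have hM1 : 1 ≤ M := by have := Module.finrank_pos (R := ℝ) (M := V); omega
  have hball : (volume : Measure V).real (Metric.ball 0 1) = Real.pi ^ M / M.factorial := by
    rw [Measure.real, InnerProductSpace.volume_ball_of_dim_even hM]
    rw [ENNReal.ofReal_one, one_pow, one_mul, ENNReal.toReal_ofReal (by positivity)]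
  set c : ℝ := (Real.pi * v) ^ (Module.finrank ℝ V / 2 : ℝ) with hc
  rw [isotropicGaussian_eq_withDensity hv, map_norm_withDensity volume
    (g := fun r => c⁻¹ * Real.exp (-(r ^ 2 / v))) (fun r => by positivity)
    ((integrable_exp_neg_norm_sq_div hv).const_mul _), nakagami]
  congr 1
  ext r
  congr 1
  obtain ⟨m, rfl⟩ := Nat.exists_eq_add_of_le' hM1
  rw [nakagamiDensity, hc, hball, hM, Nat.cast_mul, Nat.cast_two,
    mul_div_cancel_left₀ _ two_ne_zero, Real.rpow_natCast, mul_pow, Nat.factorial_succ,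
    Nat.cast_succ (R := ℝ), Real.Gamma_nat_eq_factorial]
  push_cast
  field_simp

end GaussianDensity

theorem IsContinuousPDF.unique {E : Type*} [MeasureSpace E] [TopologicalSpace E]
    [OpensMeasurableSpace E] [(volume : Measure E).IsOpenPosMeasure]
    [SigmaFinite (volume : Measure E)] {μ : Measure E} {f g : E → ℝ}
    (hf : IsContinuousPDF μ f) (hg : IsContinuousPDF μ g) : f = g := by
  have h := (withDensity_eq_iff_of_sigmaFinite hf.1.measurable.ennreal_ofReal.aemeasurable
    hg.1.measurable.ennreal_ofReal.aemeasurable).1 (hf.2.2.symm.trans hg.2.2)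
  refine (hf.1.ae_eq_iff_eq volume hg.1).1 (h.mono fun x hx => ?_)
  exact (ENNReal.ofReal_eq_ofReal_iff (hf.2.1 x) (hg.2.1 x)).1 hx

theorem IsContinuousPDF.prod {E F : Type*} [MeasureSpace E] [TopologicalSpace E]
    [OpensMeasurableSpace E] [MeasureSpace F] [TopologicalSpace F]
    [OpensMeasurableSpace F] [SFinite (volume : Measure F)]
    {μ : Measure E} {ν : Measure F} {f : E → ℝ} {g : F → ℝ}
    (hf : IsContinuousPDF μ f) (hg : IsContinuousPDF ν g) :
    IsContinuousPDF (μ.prod ν) (fun p => f p.1 * g p.2) := by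
  refine ⟨(hf.1.comp continuous_fst).mul (hg.1.comp continuous_snd),
    fun p => mul_nonneg (hf.2.1 _) (hg.2.1 _), ?_⟩
  rw [hf.2.2, hg.2.2, prod_withDensity hf.1.measurable.ennreal_ofReal
    hg.1.measurable.ennreal_ofReal]
  simp_rw [ENNReal.ofReal_mul (hf.2.1 _)]
  rfl

theorem IsContinuousPDF.conv {E : Type*} [NormedAddCommGroup E] [MeasureSpace E] [BorelSpace E]
    [SecondCountableTopology E] [SFinite (volume : Measure E)]
    [(volume : Measure E).IsAddRightInvariant] {μ ν : Measure E} [IsFiniteMeasure μ]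
    {g : E → ℝ} {C : ℝ} (hg : IsContinuousPDF ν g) (hC : ∀ x, g x ≤ C) :
    IsContinuousPDF (μ ∗ ν) (fun x => ∫ r, g (x - r) ∂μ) := by
  have : SFinite ν := hg.2.2 ▸ inferInstance
  have hnorm (x : E) : ‖g x‖ ≤ C := (Real.norm_of_nonneg (hg.2.1 x)).trans_le (hC x)
  have hmeas (x : E) : AEStronglyMeasurable (fun r => g (x - r)) μ :=
    (hg.1.comp (continuous_sub_left x)).aestronglyMeasurable
  refine ⟨continuous_of_dominated hmeas (fun x => .of_forall fun r => hnorm _)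
    (integrable_const C) (.of_forall fun r => hg.1.comp (continuous_sub_right r)),
    fun x => integral_nonneg fun r => hg.2.1 _, ?_⟩
  ext A hA
  have htranslate (r : E) : ν ((r + ·) ⁻¹' A) = ∫⁻ x in A, ENNReal.ofReal (g (x - r)) := by
    have hrA : MeasurableSet ((r + ·) ⁻¹' A) := measurable_const_add r hA
    rw [hg.2.2, withDensity_apply _ hrA, ← lintegral_indicator hrA, ← lintegral_indicator hA,
      ← lintegral_sub_right_eq_self _ r]
    refine lintegral_congr fun x => ?_
    by_cases hx : x ∈ A <;> simp [hx]
  calc (μ ∗ ν) A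
    _ = ∫⁻ r, ν ((r + ·) ⁻¹' A) ∂μ := by
        rw [Measure.conv, Measure.map_apply measurable_add hA,
          Measure.prod_apply (measurable_add hA)]
        rfl
    _ = ∫⁻ x in A, ∫⁻ r, ENNReal.ofReal (g (x - r)) ∂μ := by
        simp_rw [htranslate]
        refine lintegral_lintegral_swap (Measurable.aemeasurable ?_)
        exact (hg.1.measurable.comp (measurable_snd.sub measurable_fst)).ennreal_ofReal
    _ = volume.withDensity (fun x => ENNReal.ofReal (∫ r, g (x - r) ∂μ)) A := by
        rw [withDensity_apply _ hA]
        refine lintegral_congr fun x => (ofReal_integral_eq_lintegral_ofReal ?_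
          (.of_forall fun r => hg.2.1 _)).symm
        exact .of_bound (hmeas x) C (.of_forall fun r => hnorm _)

theorem isContinuousPDF_gaussianReal (m : ℝ) {v : NNReal} (hv : v ≠ 0) :
    IsContinuousPDF (gaussianReal m v) (gaussianPDFReal m v) :=
  ⟨by unfold gaussianPDFReal; fun_prop, gaussianPDFReal_nonneg m v,
    gaussianReal_of_var_ne_zero m hv⟩

theorem gaussianPDFReal_half {w : ℝ} (hw : 0 ≤ w) (y : ℝ) :
    gaussianPDFReal 0 (w / 2).toNNReal y = 1 / √(Real.pi * w) * Real.exp (-(y ^ 2 / w)) := by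
  rw [gaussianPDFReal, Real.coe_toNNReal _ (by positivity), one_div, sub_zero]
  ring_nf

theorem gaussianPDFReal_le (m : ℝ) (v : NNReal) (x : ℝ) :
    gaussianPDFReal m v x ≤ (√(2 * Real.pi * v))⁻¹ := by
  refine mul_le_of_le_one_right (by positivity) (Real.exp_le_one_iff.2 ?_)
  rw [neg_div, neg_nonpos]
  positivity

theorem integral_mul_comp_mul_sq_Ioi {A : ℝ} (hA : 0 < A) (g : ℝ → ℝ) :
    ∫ u in Ioi (0 : ℝ), 2 * A * u * g (A * u ^ 2) = ∫ t in Ioi (0 : ℝ), g t := by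
  have hsq := integral_comp_rpow_Ioi_of_pos (g := fun t => A * g (A * t)) (zero_lt_two (α := ℝ))
  have hmul := integral_comp_mul_left_Ioi g 0 hA
  rw [integral_const_mul, hmul, mul_zero, smul_eq_mul, mul_inv_cancel_left₀ hA.ne'] at hsq
  rw [← hsq]
  refine setIntegral_congr_fun measurableSet_Ioi fun u _ => ?_
  norm_num
  ring

theorem two_mul_integral_pow_mul_exp_mul_comp {A : ℝ} (hA : 0 < A) (n : ℕ) (φ : ℝ → ℝ) :
    2 * ∫ u in Ioi (0 : ℝ), u ^ n * Real.exp (-(A * u ^ 2)) * φ (A * u ^ 2) =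
      A ^ (-(((n : ℝ) + 1) / 2)) *
        ∫ t in Ioi (0 : ℝ), t ^ (((n : ℝ) + 1) / 2 - 1) * Real.exp (-t) * φ t := by
  rw [← integral_mul_comp_mul_sq_Ioi hA fun t => t ^ (((n : ℝ) + 1) / 2 - 1) * Real.exp (-t) * φ t,
    ← integral_const_mul, ← integral_const_mul]
  refine setIntegral_congr_fun measurableSet_Ioi fun u (hu : 0 < u) => ?_
  have hpow : u * (A * u ^ 2) ^ (((n : ℝ) + 1) / 2 - 1) * A =
      A ^ (((n : ℝ) + 1) / 2) * u ^ n := by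
    have hsq : (A * u ^ 2) ^ (((n : ℝ) + 1) / 2) = A ^ (((n : ℝ) + 1) / 2) * (u ^ n * u) := by
      rw [Real.mul_rpow hA.le (by positivity), ← Real.rpow_natCast_mul hu.le,
        ← pow_succ, ← Real.rpow_natCast u (n + 1)]
      push_cast
      ring_nf
    rw [Real.rpow_sub_one (by positivity), hsq]
    field_simp
  rw [Real.rpow_neg hA.le]
  have hAs : A ^ (((n : ℝ) + 1) / 2) ≠ 0 := (Real.rpow_pos_of_pos hA _).ne'
  rw [eq_inv_mul_iff_mul_eq₀ hAs]
  linear_combination -(2 * Real.exp (-(A * u ^ 2)) * φ (A * u ^ 2)) * hpow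

theorem two_mul_integral_pow_mul_exp_Ioi {A : ℝ} (hA : 0 < A) (n : ℕ) :
    2 * ∫ u in Ioi (0 : ℝ), u ^ n * Real.exp (-(A * u ^ 2)) =
      A ^ (-(((n : ℝ) + 1) / 2)) * Real.Gamma (((n : ℝ) + 1) / 2) := by
  have h := two_mul_integral_pow_mul_exp_mul_comp hA n fun _ => 1
  simp only [mul_one] at h
  rw [h, Real.Gamma_eq_integral (by positivity)]
  simp_rw [mul_comm (Real.exp _)]

theorem two_mul_integral_pow_mul_exp {A : ℝ} (hA : 0 < A) (n : ℕ) {a : ℝ} (ha : 0 ≤ a) :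
    2 * ∫ u in (0 : ℝ)..a, u ^ n * Real.exp (-(A * u ^ 2)) =
      A ^ (-(((n : ℝ) + 1) / 2)) * lowerGamma (((n : ℝ) + 1) / 2) (A * a ^ 2) := by
  have hrestrict (f : ℝ → ℝ) (c : ℝ) :
      ∫ t in Ioi (0 : ℝ), f t * (Set.Iic c).indicator 1 t = ∫ t in Ioc 0 c, f t := by
    simp_rw [← Set.indicator_mul_right, Pi.one_apply, mul_one]
    rw [setIntegral_indicator measurableSet_Iic, Set.Ioi_inter_Iic]
  have hmem (u : ℝ) (hu : u ∈ Ioi (0 : ℝ)) : A * u ^ 2 ∈ Set.Iic (A * a ^ 2) ↔ u ∈ Set.Iic a := by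
    rw [Set.mem_Iic, mul_le_mul_iff_right₀ hA, sq_le_sq₀ (le_of_lt hu) ha, Set.mem_Iic]
  have h := two_mul_integral_pow_mul_exp_mul_comp hA n ((Set.Iic (A * a ^ 2)).indicator 1)
  rw [hrestrict, ← intervalIntegral.integral_of_le (by positivity)] at h
  rw [lowerGamma, ← h, intervalIntegral.integral_of_le ha, ← hrestrict]
  congr 1
  refine setIntegral_congr_fun measurableSet_Ioi fun u hu => ?_
  by_cases hua : u ∈ Set.Iic a
  · simp [Set.indicator_of_mem, hua, (hmem u hu).2 hua]
  · simp [Set.indicator_of_notMem, hua, (hmem u hu).not.2 hua]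

theorem integrable_pow_mul_exp {A : ℝ} (hA : 0 < A) (n : ℕ) :
    Integrable fun u : ℝ => u ^ n * Real.exp (-(A * u ^ 2)) := by
  have hn : (-1 : ℝ) < n := neg_one_lt_zero.trans_le n.cast_nonneg
  simpa only [Real.rpow_natCast, neg_mul] using integrable_rpow_mul_exp_neg_mul_sq hA hn

theorem two_mul_integral_pow_mul_exp_neg_left {A : ℝ} (hA : 0 < A) (n : ℕ) (m : ℝ) :
    2 * ∫ u in -m..0, u ^ n * Real.exp (-(A * u ^ 2)) =
      A ^ (-(((n : ℝ) + 1) / 2)) *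
        (signCoeff n m * lowerGamma (((n : ℝ) + 1) / 2) (A * m ^ 2)) := by
  rw [mul_left_comm, signCoeff]
  split_ifs with hm
  · have hreflect := intervalIntegral.integral_comp_neg (a := 0) (b := m)
      (fun u : ℝ => u ^ n * Real.exp (-(A * u ^ 2)))
    rw [neg_zero] at hreflect
    rw [← hreflect, ← two_mul_integral_pow_mul_exp hA n hm.le, mul_left_comm]
    congr 1
    rw [← intervalIntegral.integral_const_mul]
    simp_rw [neg_sq, ← mul_assoc, ← neg_pow]
  · rw [← neg_sq m, ← two_mul_integral_pow_mul_exp hA n (neg_nonneg.2 (not_lt.1 hm)),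
      intervalIntegral.integral_symm]
    ring

theorem two_mul_integral_pow_mul_exp_Ioi_neg {A : ℝ} (hA : 0 < A) (n : ℕ) (m : ℝ) :
    2 * ∫ u in Ioi (-m), u ^ n * Real.exp (-(A * u ^ 2)) =
      A ^ (-(((n : ℝ) + 1) / 2)) * (Real.Gamma (((n : ℝ) + 1) / 2) +
        signCoeff n m * lowerGamma (((n : ℝ) + 1) / 2) (A * m ^ 2)) := by
  have hint := integrable_pow_mul_exp hA n
  rw [← intervalIntegral.integral_interval_add_Ioi (b := 0) hint.integrableOn hint.integrableOn,
    mul_add, two_mul_integral_pow_mul_exp_neg_left hA, two_mul_integral_pow_mul_exp_Ioi hA,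
    ← mul_add, add_comm (signCoeff n m * _)]

theorem integral_two_mul_pow_mul_exp_sub {A : ℝ} (hA : 0 < A) (N : ℕ) (m : ℝ) :
    ∫ r in Ioi (0 : ℝ), 2 * r ^ N * Real.exp (-(A * (r - m) ^ 2)) =
      ∑ n ∈ Finset.range (N + 1), (N.choose n : ℝ) * (m ^ (N - n) *
        (A ^ (-(((n : ℝ) + 1) / 2)) * (Real.Gamma (((n : ℝ) + 1) / 2) +
          signCoeff n m * lowerGamma (((n : ℝ) + 1) / 2) (A * m ^ 2)))) := by
  have hshift := (measurePreserving_add_right (volume : Measure ℝ) m).setIntegral_preimage_emb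
    (MeasurableEquiv.addRight m).measurableEmbedding
    (fun r => 2 * r ^ N * Real.exp (-(A * (r - m) ^ 2))) (Ioi 0)
  rw [Set.preimage_add_const_Ioi, zero_sub] at hshift
  rw [← hshift]
  simp_rw [← two_mul_integral_pow_mul_exp_Ioi_neg hA, ← integral_const_mul]
  rw [← integral_finsetSum]
  · refine integral_congr_ae (.of_forall fun u => ?_)
    simp only [add_sub_cancel_right, add_pow, Finset.mul_sum, Finset.sum_mul]
    exact Finset.sum_congr rfl fun n _ => by ring
  · exact fun n _ =>
      ((((integrable_pow_mul_exp hA n).const_mul 2).const_mul _).const_mul _).integrableOn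

theorem nakagamiDensity_mul_gaussianPDFReal (M : ℕ) {v w : ℝ} (hv : 0 < v) (hw : 0 < w)
    (x r : ℝ) :
    nakagamiDensity M v r * gaussianPDFReal 0 (w / 2).toNNReal (x - r) =
      Real.exp (-(x ^ 2 / w) * (1 - v / (v + w))) / (Real.Gamma M * v ^ M * √(Real.pi * w)) *
        (2 * r ^ (2 * M - 1) *
          Real.exp (-((1 / v + 1 / w) * (r - x / w / (1 / v + 1 / w)) ^ 2))) := by
  have hexp : Real.exp (-(r ^ 2 / v)) * Real.exp (-((x - r) ^ 2 / w)) =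
      Real.exp (-(x ^ 2 / w) * (1 - v / (v + w))) *
        Real.exp (-((1 / v + 1 / w) * (r - x / w / (1 / v + 1 / w)) ^ 2)) := by
    rw [← Real.exp_add, ← Real.exp_add]
    congr 1
    field_simp
    ring
  rw [nakagamiDensity, gaussianPDFReal_half hw.le]
  linear_combination
    2 * r ^ (2 * M - 1) / (Real.Gamma M * v ^ M * √(Real.pi * w)) * hexp

theorem integral_nakagami (M : ℕ) {v : ℝ} (hv : 0 ≤ v) (g : ℝ → ℝ) :
    ∫ r, g r ∂nakagami M v = ∫ r in Ioi (0 : ℝ), nakagamiDensity M v r * g r := by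
  have hmeas : Measurable (nakagamiDensity M v) := by unfold nakagamiDensity; fun_prop
  rw [nakagami, integral_withDensity_eq_integral_toReal_smul hmeas.ennreal_ofReal (by simp)]
  refine setIntegral_congr_fun measurableSet_Ioi fun r hr => ?_
  rw [ENNReal.toReal_ofReal (nakagamiDensity_nonneg M hv (le_of_lt hr)), smul_eq_mul]

theorem div_pow_mul_rpow_neg_mul {A : ℝ} (hA : 0 < A) {M n : ℕ} (hn : n < 2 * M) (y G : ℝ) :
    (y / A) ^ (2 * M - 1 - n) * (A ^ (-(((n : ℝ) + 1) / 2)) * G) =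
      G / (y ^ ((n : ℤ) + 1 - 2 * (M : ℤ)) * A ^ (2 * (M : ℝ) - ((n : ℝ) + 1) / 2)) := by
  obtain ⟨j, hj⟩ : ∃ j, 2 * M = n + 1 + j := Nat.exists_eq_add_of_le hn
  have hjℤ : (n : ℤ) + 1 - 2 * (M : ℤ) = -(j : ℤ) := by omega
  have hjℝ : 2 * (M : ℝ) - ((n : ℝ) + 1) / 2 = j + ((n : ℝ) + 1) / 2 := by
    have : 2 * (M : ℝ) = n + 1 + j := by exact_mod_cast hj
    linarith
  have hexp : 2 * M - 1 - n = j := by omega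
  rw [hjℤ, hjℝ, hexp, zpow_neg, zpow_natCast, Real.rpow_add hA, Real.rpow_natCast,
    Real.rpow_neg hA.le, div_pow, div_eq_mul_inv G, mul_inv, mul_inv, inv_inv]
  ring

theorem integral_gaussianPDFReal_sub_nakagami {M : ℕ} (hM : 1 ≤ M) {ρ q σ b α : ℝ}
    (h₁ : 0 < lam1 ρ q σ b α) (h₂ : 0 < lam2 ρ q σ b α) (x : ℝ) :
    ∫ r, gaussianPDFReal 0 (lam2 ρ q σ b α / 2).toNNReal (x - r) ∂nakagami M (lam1 ρ q σ b α) =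
      f1 M ρ q σ b x α := by
  simp only [f1, integral_nakagami M h₁.le]
  generalize lam1 ρ q σ b α = l₁ at *
  generalize lam2 ρ q σ b α = l₂ at *
  have hA : 0 < 1 / l₁ + 1 / l₂ := by positivity
  have harg : x ^ 2 / l₂ * (l₁ / (l₁ + l₂)) =
      (1 / l₁ + 1 / l₂) * (x / l₂ / (1 / l₁ + 1 / l₂)) ^ 2 := by
    field_simp
    ring
  have hsign (n : ℕ) : signCoeff n (x / l₂ / (1 / l₁ + 1 / l₂)) = signCoeff n x := by
    simp only [signCoeff, div_pos_iff_of_pos_right hA, div_pos_iff_of_pos_right h₂]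
  simp_rw [nakagamiDensity_mul_gaussianPDFReal M h₁ h₂, integral_const_mul]
  rw [integral_two_mul_pow_mul_exp_sub hA, harg, show 2 * M - 1 + 1 = 2 * M by omega]
  congr 1
  refine Finset.sum_congr rfl fun n hn => ?_
  rw [hsign, div_pow_mul_rpow_neg_mul hA (Finset.mem_range.1 hn)]

theorem isotropicGaussian_ae_ne_zero {V : Type*} [NormedAddCommGroup V] [InnerProductSpace ℝ V]
    [FiniteDimensional ℝ V] [MeasurableSpace V] [BorelSpace V] [Nontrivial V] {v : ℝ}
    (hv : 0 < v) : ∀ᵐ x ∂isotropicGaussian V v, x ≠ 0 := by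
  rw [isotropicGaussian_eq_withDensity hv]
  exact (withDensity_absolutelyContinuous _ _).ae_le (Measure.ae_ne volume 0)

theorem measurePreserving_norm_inner_add {ι : Type*} [Fintype ι] [Nonempty ι] {v w s : ℝ}
    (hv : 0 < v) (hw : 0 ≤ w) (hs : 0 ≤ s) :
    MeasurePreserving
      (fun p : (EuclideanSpace ℂ ι × EuclideanSpace ℂ ι) × ℂ =>
        (‖p.1.1‖, inner ℂ p.1.2 (‖p.1.1‖⁻¹ • p.1.1) + p.2))
      (((isotropicGaussian _ v).prod (isotropicGaussian _ w)).prod (isotropicGaussian ℂ s))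
      (((isotropicGaussian (EuclideanSpace ℂ ι) v).map norm).prod
        (isotropicGaussian ℂ (w + s))) := by
  have hfiber : ∀ᵐ x ∂isotropicGaussian (EuclideanSpace ℂ ι) v,
      ((isotropicGaussian (EuclideanSpace ℂ ι) w).prod (isotropicGaussian ℂ s)).map
        (fun p => inner ℂ p.1 (‖x‖⁻¹ • x) + p.2) = isotropicGaussian ℂ (w + s) := by
    filter_upwards [isotropicGaussian_ae_ne_zero hv] with x hx
    have hinner : MeasurePreserving (fun u => inner ℂ u (‖x‖⁻¹ • x))
        (isotropicGaussian (EuclideanSpace ℂ ι) w) (isotropicGaussian ℂ w) :=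
      ⟨by fun_prop, isotropicGaussian_map_inner hw (norm_smul_inv_norm (𝕜 := ℝ) hx)⟩
    rw [← isotropicGaussian_conv hw hs]
    exact ((measurable_add.measurePreserving _).comp (hinner.prod (.id _))).map_eq
  have hnorm : MeasurePreserving (fun x => ‖x‖) (isotropicGaussian (EuclideanSpace ℂ ι) v)
      ((isotropicGaussian (EuclideanSpace ℂ ι) v).map norm) :=
    measurable_norm.measurePreserving _
  have hskew := hnorm.skew_product (g := fun x (p : EuclideanSpace ℂ ι × ℂ) =>
    inner ℂ p.1 (‖x‖⁻¹ • x) + p.2) (by unfold Function.uncurry; fun_prop) hfiber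
  exact (hskew.comp (measurePreserving_prodAssoc _ _ _) :)

theorem measurePreserving_add_re_im (μ : Measure ℝ) [SFinite μ] (w : ℝ) :
    MeasurePreserving (fun p : ℝ × ℂ => (p.1 + p.2.re, p.2.im)) (μ.prod (complexGaussian w))
      ((μ ∗ gaussianReal 0 (w / 2).toNNReal).prod (gaussianReal 0 (w / 2).toNNReal)) := by
  have hsplit : MeasurePreserving (fun z : ℂ => (z.re, z.im)) (complexGaussian w)
      ((gaussianReal 0 (w / 2).toNNReal).prod (gaussianReal 0 (w / 2).toNNReal)) :=
    MeasurePreserving.symm Complex.measurableEquivRealProd.symm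
      (Complex.measurableEquivRealProd.symm.measurable.measurePreserving _)
  have hadd : MeasurePreserving (fun p : ℝ × ℝ => p.1 + p.2)
      (μ.prod (gaussianReal 0 (w / 2).toNNReal)) (μ ∗ gaussianReal 0 (w / 2).toNNReal) :=
    measurable_add.measurePreserving _
  exact (hadd.prod (.id _)).comp ((measurePreserving_prodAssoc _ _ _).symm.comp
    ((MeasurePreserving.id μ).prod hsplit))

-- `hk` and `hc` say that `c • ∑ i, g i • X i` has the same covariance `l` with `s • X k` as with
-- itself, so that it is uncorrelated with the residual.
theorem hasLaw_estimate_residual {ι Ω V : Type*} [Fintype ι] [MeasurableSpace Ω] {P : Measure Ω}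
    [NormedAddCommGroup V] [InnerProductSpace ℝ V] [FiniteDimensional ℝ V] [MeasurableSpace V]
    [BorelSpace V] {X : ι → Ω → V} {v g : ι → ℝ} (hX : iIndepFun X P)
    (hlaw : ∀ i, HasLaw (X i) (isotropicGaussian V (v i)) P) (hv : ∀ i, 0 ≤ v i)
    {k : ι} {s c l : ℝ} (hk : c * s * (v k * g k) = l) (hc : c ^ 2 * ∑ i, v i * g i ^ 2 = l) :
    HasLaw (fun ω => (c • ∑ i, g i • X i ω, s • X k ω - c • ∑ i, g i • X i ω))
      ((isotropicGaussian V l).prod (isotropicGaussian V (s ^ 2 * v k - l))) P := by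
  classical
  have ha : ∑ i, v i * (c * g i) ^ 2 = l := by
    rw [← hc, Finset.mul_sum]
    exact Finset.sum_congr rfl fun i _ => by ring
  have hcross : ∑ i, v i * (c * g i) * (Pi.single k s : ι → ℝ) i = l := by
    rw [← hk, Fintype.sum_eq_single k fun i hi => by rw [Pi.single_eq_of_ne hi, mul_zero],
      Pi.single_eq_same]
    ring
  have hb : ∑ i, v i * (Pi.single k s : ι → ℝ) i ^ 2 = s ^ 2 * v k := by
    rw [Fintype.sum_eq_single k fun i hi => by rw [Pi.single_eq_of_ne hi]; ring,
      Pi.single_eq_same, mul_comm]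
  have hab : ∑ i, v i * (c * g i) * ((Pi.single k s : ι → ℝ) i - c * g i) = 0 := by
    simp only [mul_sub, Finset.sum_sub_distrib, hcross]
    simp only [mul_assoc _ (c * g _), ← sq, ha, sub_self]
  have hres : ∑ i, v i * ((Pi.single k s : ι → ℝ) i - c * g i) ^ 2 = s ^ 2 * v k - l := by
    have hsq (i : ι) : v i * ((Pi.single k s : ι → ℝ) i - c * g i) ^ 2 =
        v i * (Pi.single k s : ι → ℝ) i ^ 2 - v i * (c * g i) ^ 2 -
          2 * (v i * (c * g i) * ((Pi.single k s : ι → ℝ) i - c * g i)) := by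
      ring
    simp_rw [hsq, Finset.sum_sub_distrib, ← Finset.mul_sum, hb, ha, hab, mul_zero, sub_zero]
  have hlaw := hasLaw_sum_smul_prod hX hlaw hv hab
  rw [ha, hres] at hlaw
  have hsingle (ω : Ω) : ∑ i, (Pi.single k s : ι → ℝ) i • X i ω = s • X k ω := by
    rw [Fintype.sum_eq_single k fun i hi => by rw [Pi.single_eq_of_ne hi, zero_smul],
      Pi.single_eq_same]
  simpa only [sub_smul, Finset.sum_sub_distrib, mul_smul, ← Finset.smul_sum, hsingle] using hlaw

theorem finrank_real_euclideanSpace_complex (M : ℕ) :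
    Module.finrank ℝ (EuclideanSpace ℂ (Fin M)) = 2 * M := by
  rw [← Module.finrank_mul_finrank ℝ ℂ, Complex.finrank_real_complex, finrank_euclideanSpace_fin]

theorem isProbabilityMeasure_nakagami {M : ℕ} (hM : 1 ≤ M) {v : ℝ} (hv : 0 < v) :
    IsProbabilityMeasure (nakagami M v) := by
  have : Nonempty (Fin M) := ⟨⟨0, hM⟩⟩
  rw [← isotropicGaussian_map_norm (finrank_real_euclideanSpace_complex M) hv]
  exact Measure.isProbabilityMeasure_map (by fun_prop)

section Gains

variable {ρ q σ b α : ℝ}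

theorem lam1_pos (hρ : 0 < ρ) (hq : 0 < q) (hb : 0 < b) (hα : 0 < α) : 0 < lam1 ρ q σ b α := by
  rw [lam1]
  positivity

theorem lam1_lt (hρ : 0 < ρ) (hq : 0 < q) (hσ : 0 < σ) (hb : 0 < b) (hα : b ≤ α) :
    lam1 ρ q σ b α < q * b := by
  have := hb.trans_le hα
  have hle : q * b * (ρ * b) ≤ q * b * (ρ * α) := by gcongr
  have hpos : 0 < q * b * σ ^ 2 := by positivity
  rw [lam1, div_lt_iff₀ (by positivity)]
  linarith

theorem lam2_pos (hρ : 0 < ρ) (hq : 0 < q) (hσ : 0 < σ) (hb : 0 < b) (hα : b ≤ α) :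
    0 < lam2 ρ q σ b α := by
  have := lam1_lt hρ hq hσ hb hα
  have := sq_nonneg σ
  rw [lam2]
  linarith

end Gains

section ReceivedSignal

variable {M K : ℕ} {ρ q σ : ℝ} {β : Fin K → ℝ} {S : Finset (Fin K)} {k : Fin K}

theorem precoder_eq_of_pos {c : ℝ} (hρ : 0 < ρ) (hc : 0 < c)
    (h : Fin K → EuclideanSpace ℂ (Fin M)) (n : EuclideanSpace ℂ (Fin M)) :
    precoder ρ q S h n = √q • ‖c • uplinkSignal ρ S h n‖⁻¹ • c • uplinkSignal ρ S h n := by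
  have := Real.sqrt_pos.2 hρ
  simp only [precoder, lsEstimate, Complex.coe_smul, norm_smul, Real.norm_eq_abs, smul_smul]
  rw [abs_of_pos (by positivity), abs_of_pos hc]
  congr 1
  field_simp

theorem inner_norm_inv_smul_self {ι : Type*} [Fintype ι] (x : EuclideanSpace ℂ ι) :
    inner ℂ x (‖x‖⁻¹ • x) = (‖x‖ : ℂ) := by
  rw [← Complex.coe_smul, inner_smul_right, inner_self_eq_norm_sq_to_K,
    RCLike.ofReal_eq_complex_ofReal, ← Complex.ofReal_pow, ← Complex.ofReal_mul, mul_comm,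
    sq, mul_self_mul_inv]

theorem receivedSignal_eq_of_pos {c : ℝ} (hρ : 0 < ρ) (hc : 0 < c)
    (h : Fin K → EuclideanSpace ℂ (Fin M)) (n : EuclideanSpace ℂ (Fin M)) (η : ℂ) :
    receivedSignal ρ q S k h n η =
      ‖c • uplinkSignal ρ S h n‖ +
        (inner ℂ (√q • h k - c • uplinkSignal ρ S h n)
          (‖c • uplinkSignal ρ S h n‖⁻¹ • c • uplinkSignal ρ S h n) + η) := by
  rw [receivedSignal, precoder_eq_of_pos hρ hc, inner_sub_left, inner_norm_inv_smul_self,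
    ← add_assoc, add_sub_cancel, ← Complex.coe_smul √q, ← Complex.coe_smul √q, inner_smul_left,
    inner_smul_right, Complex.conj_ofReal]

theorem uplinkSignal_eq_sum (X : Option (Fin K) → EuclideanSpace ℂ (Fin M)) :
    uplinkSignal ρ S (fun i => X (some i)) (X none) =
      ∑ o, (o.elim 1 fun i => if i ∈ S then √ρ else 0) • X o := by
  simp [uplinkSignal, Fintype.sum_option, ite_smul, add_comm, Finset.sum_ite_mem]

theorem exists_hasLaw_estimate_residual (hρ : 0 < ρ) (hq : 0 < q) (hσ : 0 < σ)
    (hβ : ∀ i, 0 < β i) (hk : k ∈ S) {Ω : Type*} [MeasurableSpace Ω] {P : Measure Ω}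
    {h : Fin K → Ω → EuclideanSpace ℂ (Fin M)} {n : Ω → EuclideanSpace ℂ (Fin M)} {η : Ω → ℂ}
    (H : IsRayleighModel P σ β h n η) :
    ∃ c : ℝ, 0 < c ∧ HasLaw (fun ω => (c • uplinkSignal ρ S (fun i => h i ω) (n ω),
        √q • h k ω - c • uplinkSignal ρ S (fun i => h i ω) (n ω)))
      ((isotropicGaussian _ (lam1 ρ q σ (β k) (∑ i ∈ S, β i))).prod
        (isotropicGaussian _ (q * β k - lam1 ρ q σ (β k) (∑ i ∈ S, β i)))) P := by
  have hα : 0 < ∑ i ∈ S, β i := Finset.sum_pos (fun i _ => hβ i) ⟨k, hk⟩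
  have hv (o : Option (Fin K)) : 0 ≤ o.elim (σ ^ 2) β :=
    o.casesOn (sq_nonneg σ) fun i => (hβ i).le
  have hlaw (o : Option (Fin K)) : HasLaw (o.elim n h)
      (isotropicGaussian (EuclideanSpace ℂ (Fin M)) (o.elim (σ ^ 2) β)) P := by
    rw [isotropicGaussian_euclideanSpace M (hv o)]
    exact o.casesOn H.law_noise H.law_channel
  have hsum : ∑ o : Option (Fin K), o.elim (σ ^ 2) β *
      (o.elim 1 fun i => if i ∈ S then √ρ else 0) ^ 2 = ρ * ∑ i ∈ S, β i + σ ^ 2 := by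
    simp [Fintype.sum_option, ite_pow, Real.sq_sqrt hρ.le, Finset.mul_sum, mul_comm, add_comm]
  have : 0 < ρ * ∑ i ∈ S, β i + σ ^ 2 := by positivity
  have := hβ k
  refine ⟨√q * √ρ * β k / (ρ * ∑ i ∈ S, β i + σ ^ 2), by positivity, ?_⟩
  have hgain := hasLaw_estimate_residual H.indep_channels_noise hlaw hv (k := some k)
    (g := fun o => o.elim 1 fun i => if i ∈ S then √ρ else 0)
    (s := √q) (c := √q * √ρ * β k / (ρ * ∑ i ∈ S, β i + σ ^ 2))
    (l := lam1 ρ q σ (β k) (∑ i ∈ S, β i)) ?_ ?_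
  · simp only [← uplinkSignal_eq_sum, Real.sq_sqrt hq.le] at hgain
    exact hgain
  · simp only [Option.elim_some, if_pos hk, lam1]
    field_simp
    rw [Real.sq_sqrt hq.le, Real.sq_sqrt hρ.le, mul_comm]
  · rw [hsum, lam1]
    field_simp
    rw [Real.sq_sqrt hq.le, Real.sq_sqrt hρ.le, mul_comm q]

theorem IsRayleighModel.indepFun_estimate_residual_userNoise {Ω : Type*} [MeasurableSpace Ω]
    {P : Measure Ω} {h : Fin K → Ω → EuclideanSpace ℂ (Fin M)}
    {n : Ω → EuclideanSpace ℂ (Fin M)} {η : Ω → ℂ} (H : IsRayleighModel P σ β h n η) (c : ℝ) :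
    IndepFun (fun ω => (c • uplinkSignal ρ S (fun i => h i ω) (n ω),
      √q • h k ω - c • uplinkSignal ρ S (fun i => h i ω) (n ω))) η P := by
  have hmeas : Measurable fun p : (Fin K → EuclideanSpace ℂ (Fin M)) × EuclideanSpace ℂ (Fin M) =>
      (c • uplinkSignal ρ S p.1 p.2, √q • p.1 k - c • uplinkSignal ρ S p.1 p.2) := by
    unfold uplinkSignal
    fun_prop
  exact H.indep_userNoise.comp hmeas measurable_id

theorem hasLaw_re_im_receivedSignal (hM : 1 ≤ M) (hρ : 0 < ρ) (hq : 0 < q) (hσ : 0 < σ)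
    (hβ : ∀ i, 0 < β i) (hk : k ∈ S) {Ω : Type*} [MeasurableSpace Ω] {P : Measure Ω}
    {h : Fin K → Ω → EuclideanSpace ℂ (Fin M)} {n : Ω → EuclideanSpace ℂ (Fin M)} {η : Ω → ℂ}
    (H : IsRayleighModel P σ β h n η) :
    HasLaw (fun ω => ((receivedSignal ρ q S k (fun i => h i ω) (n ω) (η ω)).re,
        (receivedSignal ρ q S k (fun i => h i ω) (n ω) (η ω)).im))
      ((nakagami M (lam1 ρ q σ (β k) (∑ i ∈ S, β i)) ∗
          gaussianReal 0 (lam2 ρ q σ (β k) (∑ i ∈ S, β i) / 2).toNNReal).prod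
        (gaussianReal 0 (lam2 ρ q σ (β k) (∑ i ∈ S, β i) / 2).toNNReal)) P := by
  have hα : β k ≤ ∑ i ∈ S, β i := Finset.single_le_sum (fun i _ => (hβ i).le) hk
  have hl₁ := lam1_pos (σ := σ) hρ hq (hβ k) ((hβ k).trans_le hα)
  have hw := sub_nonneg.2 (lam1_lt hρ hq hσ (hβ k) hα).le
  have hw₂ : q * β k - lam1 ρ q σ (β k) (∑ i ∈ S, β i) + σ ^ 2 =
      lam2 ρ q σ (β k) (∑ i ∈ S, β i) := by
    rw [lam2]
    ring
  have : Nonempty (Fin M) := ⟨⟨0, hM⟩⟩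
  have := isProbabilityMeasure_nakagami hM hl₁
  obtain ⟨c, hc, hxu⟩ := exists_hasLaw_estimate_residual hρ hq hσ hβ hk H
  have := H.law_userNoise.isProbabilityMeasure
  have hxuη := IndepFun.hasLaw_prod hxu H.law_userNoise (H.indepFun_estimate_residual_userNoise c)
  rw [← isotropicGaussian_complex (sq_nonneg σ)] at hxuη
  have hrad := (measurePreserving_norm_inner_add hl₁ hw (sq_nonneg σ)).fun_comp_hasLaw hxuη
  rw [hw₂, isotropicGaussian_complex (lam2_pos hρ hq hσ (hβ k) hα).le,
    isotropicGaussian_map_norm (finrank_real_euclideanSpace_complex M) hl₁] at hrad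
  refine ((measurePreserving_add_re_im _ _).fun_comp_hasLaw hrad).congr (.of_forall fun ω => ?_)
  simp only [receivedSignal_eq_of_pos hρ hc, Complex.add_re, Complex.add_im, Complex.ofReal_re,
    Complex.ofReal_im, zero_add]

end ReceivedSignal

section Densities

variable {M K : ℕ} {ρ q σ b α : ℝ} {β : Fin K → ℝ} {S : Finset (Fin K)} {k : Fin K}

theorem isContinuousPDF_f1 (hM : 1 ≤ M) (h₁ : 0 < lam1 ρ q σ b α) (h₂ : 0 < lam2 ρ q σ b α) :
    IsContinuousPDF
      (nakagami M (lam1 ρ q σ b α) ∗ gaussianReal 0 (lam2 ρ q σ b α / 2).toNNReal)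
      (fun x => f1 M ρ q σ b x α) := by
  have := isProbabilityMeasure_nakagami hM h₁
  simp_rw [← integral_gaussianPDFReal_sub_nakagami hM h₁ h₂]
  exact (isContinuousPDF_gaussianReal 0 (Real.toNNReal_pos.2 (half_pos h₂)).ne').conv
    (gaussianPDFReal_le 0 _)

theorem isContinuousPDF_f2 (h₂ : 0 < lam2 ρ q σ b α) :
    IsContinuousPDF (gaussianReal 0 (lam2 ρ q σ b α / 2).toNNReal)
      (fun y => f2 ρ q σ b y α) := by
  simp only [f2, ← gaussianPDFReal_half h₂.le]
  exact isContinuousPDF_gaussianReal 0 (Real.toNNReal_pos.2 (half_pos h₂)).ne'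

theorem isContinuousPDF_receivedSignal (hM : 1 ≤ M) (hρ : 0 < ρ) (hq : 0 < q) (hσ : 0 < σ)
    (hβ : ∀ i, 0 < β i) (hk : k ∈ S) {Ω : Type*} [MeasurableSpace Ω] {P : Measure Ω}
    {h : Fin K → Ω → EuclideanSpace ℂ (Fin M)} {n : Ω → EuclideanSpace ℂ (Fin M)} {η : Ω → ℂ}
    (H : IsRayleighModel P σ β h n η) {z : Ω → ℂ}
    (hz : z = fun ω => receivedSignal ρ q S k (fun i => h i ω) (n ω) (η ω)) :
    IsContinuousPDF (P.map (fun ω => (z ω).re)) (fun x => f1 M ρ q σ (β k) x (∑ i ∈ S, β i)) ∧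
    IsContinuousPDF (P.map (fun ω => (z ω).im)) (fun y => f2 ρ q σ (β k) y (∑ i ∈ S, β i)) ∧
    IsContinuousPDF (P.map (fun ω => ((z ω).re, (z ω).im)))
      (fun p => f1 M ρ q σ (β k) p.1 (∑ i ∈ S, β i) *
        f2 ρ q σ (β k) p.2 (∑ i ∈ S, β i)) := by
  subst hz
  have hα : β k ≤ ∑ i ∈ S, β i := Finset.single_le_sum (fun i _ => (hβ i).le) hk
  have h₁ := lam1_pos (σ := σ) hρ hq (hβ k) ((hβ k).trans_le hα)
  have h₂ := lam2_pos hρ hq hσ (hβ k) hα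
  have := isProbabilityMeasure_nakagami hM h₁
  have hlaw := hasLaw_re_im_receivedSignal hM hρ hq hσ hβ hk H
  have hre := measurePreserving_fst.fun_comp_hasLaw hlaw
  have him := measurePreserving_snd.fun_comp_hasLaw hlaw
  rw [hre.map_eq, him.map_eq, hlaw.map_eq]
  exact ⟨isContinuousPDF_f1 hM h₁ h₂, isContinuousPDF_f2 h₂,
    (isContinuousPDF_f1 hM h₁ h₂).prod (isContinuousPDF_f2 h₂)⟩

end Densities

theorem measurePreserving_option_elim {ι V : Type*} [Fintype ι] [MeasurableSpace V]
    (μ : Option ι → Measure V) [∀ o, SigmaFinite (μ o)] :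
    MeasurePreserving (fun (p : (ι → V) × V) (o : Option ι) => o.elim p.2 p.1)
      ((Measure.pi fun i => μ (some i)).prod (μ none)) (Measure.pi μ) := by
  have helim : (fun (p : (ι → V) × V) (o : Option ι) => o.elim p.2 p.1) =
      (MeasurableEquiv.piOptionEquivProd fun _ => V).symm := by
    ext p o
    cases o <;> rfl
  rw [helim]
  exact ⟨by fun_prop, Measure.pi_map_piOptionEquivProd μ⟩

theorem isRayleighModel_prod (M : ℕ) {K : ℕ} (σ : ℝ) (β : Fin K → ℝ) :
    IsRayleighModel
      (((Measure.pi fun i => complexGaussianVec M (β i)).prod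
        (complexGaussianVec M (σ ^ 2))).prod (complexGaussian (σ ^ 2)))
      σ β (fun i p => p.1.1 i) (fun p => p.1.2) (fun p => p.2) where
  law_channel i := ((measurePreserving_eval (fun i => complexGaussianVec M (β i)) i).comp
    (measurePreserving_fst.comp measurePreserving_fst)).hasLaw
  law_noise := (measurePreserving_snd.comp measurePreserving_fst).hasLaw
  law_userNoise := measurePreserving_snd.hasLaw
  indep_channels_noise := by
    have hjoint := (measurePreserving_option_elim fun o : Option (Fin K) =>
      complexGaussianVec M (o.elim (σ ^ 2) β)).comp
        (measurePreserving_fst (ν := complexGaussian (σ ^ 2)))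
    refine (iIndepFun_iff_hasLaw_pi_pi fun o =>
      ((measurePreserving_eval _ o).comp hjoint).hasLaw.congr ?_).2 (hjoint.hasLaw.congr ?_)
    · exact .of_forall fun p => by cases o <;> rfl
    · exact .of_forall fun p => funext fun o => by cases o <;> rfl
  indep_userNoise := indepFun_prod measurable_id measurable_id

section Likelihood

variable {M : ℕ} {ρ q σ b : ℝ}

theorem isLikelihood_f1_mul_f2 (hM : 1 ≤ M) (hρ : 0 < ρ) (hq : 0 < q) (hσ : 0 < σ) (b : ℝ) :
    IsLikelihood M ρ q σ b (fun α p => f1 M ρ q σ b p.1 α * f2 ρ q σ b p.2 α) := by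
  rintro K β S k hβ hk rfl
  exact (isContinuousPDF_receivedSignal hM hρ hq hσ hβ hk (isRayleighModel_prod M σ β) rfl).2.2

theorem exists_gains_sum_eq {α : ℝ} (hb : 0 < b) (hα : b ≤ α) :
    ∃ (K : ℕ) (β : Fin K → ℝ) (S : Finset (Fin K)) (k : Fin K),
      (∀ i, 0 < β i) ∧ k ∈ S ∧ β k = b ∧ ∑ i ∈ S, β i = α := by
  rcases hα.eq_or_lt with rfl | hlt
  · exact ⟨1, fun _ => b, Finset.univ, 0, fun _ => hb, Finset.mem_univ _, rfl,
      Fin.sum_univ_one _⟩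
  · refine ⟨2, ![b, α - b], Finset.univ, 0, ?_, Finset.mem_univ _, rfl, ?_⟩
    · exact Fin.forall_fin_two.2 ⟨hb, sub_pos.2 hlt⟩
    · exact (Fin.sum_univ_two _).trans (add_sub_cancel b α)

theorem IsLikelihood.eqOn (hb : 0 < b) {L L' : ℝ → ℝ × ℝ → ℝ} (hL : IsLikelihood M ρ q σ b L)
    (hL' : IsLikelihood M ρ q σ b L') : Set.EqOn L L' (Set.Ici b) := by
  intro α hα
  obtain ⟨K, β, S, k, hβ, hk, hkb, rfl⟩ := exists_gains_sum_eq hb hα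
  exact (hL K β S k hβ hk hkb).unique (hL' K β S k hβ hk hkb)

theorem argmaxOn_congr {A : Set ℝ} {F G : ℝ → ℝ} (hFG : Set.EqOn F G A) :
    argmaxOn A F = argmaxOn A G := by
  ext a
  refine and_congr_right fun ha => forall₂_congr fun x hx => ?_
  simp only [Set.mem_ofPred_eq, hFG hx, hFG ha]

theorem mlEstimates_eq_argmaxOn (hb : 0 < b) {L : ℝ → ℝ × ℝ → ℝ}
    (hL : IsLikelihood M ρ q σ b L) (z : ℂ) :
    mlEstimates M ρ q σ b z = argmaxOn (Set.Ici b) (fun α => L α (z.re, z.im)) := by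
  refine Set.Subset.antisymm ?_ fun a ha => ⟨L, hL, ha⟩
  rintro a ⟨L', hL', ha⟩
  rwa [argmaxOn_congr fun α hα => congrFun (hL'.eqOn hb hL hα) _] at ha

end Likelihood

end PilotContention

theorem theorem1 (M : ℕ) (hM : 1 ≤ M) (ρ q σ : ℝ) (hρ : 0 < ρ) (hq : 0 < q) (hσ : 0 < σ) :
    -- the conditional PDFs of the real part, the imaginary part, and of both jointly
    (∀ (K : ℕ) (β : Fin K → ℝ) (S : Finset (Fin K)) (k : Fin K),
      (∀ i, 0 < β i) → k ∈ S →
      ∀ (Ω : Type*) [MeasurableSpace Ω] (P : Measure Ω)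
        (h : Fin K → Ω → EuclideanSpace ℂ (Fin M)) (n : Ω → EuclideanSpace ℂ (Fin M))
        (η : Ω → ℂ), PilotContention.IsRayleighModel P σ β h n η →
      ∀ z : Ω → ℂ,
        (z = fun ω => PilotContention.receivedSignal ρ q S k (fun i => h i ω) (n ω) (η ω)) →
        PilotContention.IsContinuousPDF (P.map (fun ω => (z ω).re))
          (fun x => PilotContention.f1 M ρ q σ (β k) x (∑ i ∈ S, β i)) ∧
        PilotContention.IsContinuousPDF (P.map (fun ω => (z ω).im))
          (fun y => PilotContention.f2 ρ q σ (β k) y (∑ i ∈ S, β i)) ∧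
        PilotContention.IsContinuousPDF (P.map (fun ω => ((z ω).re, (z ω).im)))
          (fun p => PilotContention.f1 M ρ q σ (β k) p.1 (∑ i ∈ S, β i) *
            PilotContention.f2 ρ q σ (β k) p.2 (∑ i ∈ S, β i))) ∧
    -- the maximum likelihood estimate
    (∀ b : ℝ, 0 < b → ∀ z : ℂ,
      PilotContention.mlEstimates M ρ q σ b z =
        PilotContention.argmaxOn (Set.Ici b)
          (fun α => PilotContention.f1 M ρ q σ b z.re α * PilotContention.f2 ρ q σ b z.im α)) := by
  refine ⟨fun K β S k hβ hk Ω _ P h n η H z hz => ?_, fun b hb z => ?_⟩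
  · exact PilotContention.isContinuousPDF_receivedSignal hM hρ hq hσ hβ hk H hz
  · exact PilotContention.mlEstimates_eq_argmaxOn hb
      (PilotContention.isLikelihood_f1_mul_f2 hM hρ hq hσ b) z
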